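/- Setting. Let $a=x_0<x_1<\dots<x_k<x_{k+1}=b$ be a partition of $[a,b]$ and $I_i=[x_i,x_{i+1}]$, $i=0,\dots,k$. A piecewise function $F$ is a function given separately on each $I_i$ (its restriction to $I_i$ is denoted $F^{[i]}$), so that it may have two different values $F(x_i^-)$, $F(x_i^+)$ at an interior knot; derivatives $D$ are taken piecewise, one-sided at the endpoints of the $I_i$. An $m$-dimensional space $U\subset C^{m-1}(J)$, $m\ge 1$, on a closed bounded interval $J$ is an Extended Chebyshev (EC) space if every nonzero element of $U$ has at most $m-1$ zeros in $J$, counting multiplicities up to $m$. For each $i=0,\dots,k$ let $\mathcal U_{i}$ be an $m$-dimensional EC-space on $I_i$, and for $i=1,\dots,k$ let $R_i$ be an $m\times m$ real lower triangular matrix with positive diagonal entries whose first row and first column are $(1,0,\dots,0)$. Let $S$ be the space of all piecewise $C^{m-1}$ functions $F$ with $F^{[i]}\in\mathcal U_i$ for all $i$ and $$\bigl(D^0F^{[i]}(x_i),\dots,D^{m-1}F^{[i]}(x_i)\bigr)^T=R_i\,\bigl(D^0F^{[i-1]}(x_i),\dots,D^{m-1}F^{[i-1]}(x_i)\bigr)^T,\qquad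 i=1,\dots,k,$$ and let $DS=\{DF : F\in S\}$. $DS$ is called an ECP-space if it is an $(m-1)$-dimensional space of piecewise $C^{m-2}$ functions each nonzero element of which has at most $m-2$ zeros in $[a,b]$, counting multiplicities up to $m-1$ (at an interior knot $x_i$ the multiplicities at $x_i^-$ and $x_i^+$ agree, and the knot is counted once). For $a\le c<d\le b$, a Bernstein-like basis of (the restriction of) $DS$ on $[c,d]$ is a basis $B_1,\dots,B_{m-1}$ of the restriction of $DS$ to $[c,d]$ such that $B_\ell$ vanishes exactly $\ell-1$ times at $c$, exactly $m-1-\ell$ times at $d$, and is positive on $(c,d)$ (including both one-sided values at knots). Lemma. Suppose that $S$ contains the constants and that $DS$ is an ECP-space. Let $w=\sum_{\ell=1}^{m-1}\alpha_\ell B_\ell$ with all $\alpha_\ell>0$, where $B_1,\dots,B_{m-1}$ is a Bernstein-like basis of $DS$ on $[a,b]$. Then for every $[c,d]\subseteq[a,b]$ with $c<d$ there exist a Bernstein-like basis $\hat B_1,\dots,\hat B_{m-1}$ of the restriction of $DS$ to $[c,d]$ and numbers $\beta_1,\dots,\beta_{m-1}>0$ such that $w|_{[c,d]}=\sum_{\ell=1}^{m-1}\beta_\ell\hat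 B_\ell$. -/

import Mathlib

open Set

noncomputable section

/-! ### Functions on one closed interval -/

/-- The `r`-th derivative at `t ∈ [p, q]` of a function `f` on `[p, q]` (one-sided at `p` and at `q`).
The values of `Set.IccExtend` outside `[p, q]` play no role. -/
def pieceDeriv {p q : ℝ} (h : p < q) (r : ℕ) (f : Icc p q → ℝ) (t : ℝ) : ℝ :=
  iteratedDerivWithin r (IccExtend h.le f) (Icc p q) t

/-- `f ∈ C^n([p, q])`. -/
def IsCn {p q : ℝ} (h : p < q) (n : ℕ) (f : Icc p q → ℝ) : Prop :=
  ContDiffOn ℝ n (IccExtend h.le f) (Icc p q)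

/-- `f` vanishes at least `r` times at `t`: `f(t) = f'(t) = ⋯ = f^(r-1)(t) = 0`. -/
def VanishesTo {p q : ℝ} (h : p < q) (f : Icc p q → ℝ) (t : ℝ) (r : ℕ) : Prop :=
  ∀ j < r, pieceDeriv h j f t = 0

open Classical in
/-- The multiplicity, counted up to `n`, of a point at which the function vanishes at least `r`
times if and only if `van r`. -/
def cappedMult (n : ℕ) (van : ℕ → Prop) : ℕ := Nat.findGreatest van n

/-- The total number (possibly infinite) of zeros in `s`, counting multiplicities up to `n`, of a
function that vanishes at least `r` times at `t` if and only if `van t r`. -/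
def zeroCount (s : Set ℝ) (n : ℕ) (van : ℝ → ℕ → Prop) : ℕ∞ :=
  ⨆ T : {T : Finset ℝ // (T : Set ℝ) ⊆ s}, ((∑ t ∈ T.1, cappedMult n (van t) : ℕ) : ℕ∞)

/-- `U` is an `m`-dimensional Extended Chebyshev space on `[p, q]`: `m ≥ 1`, `U ⊆ C^(m-1)([p, q])`,
and any nonzero element vanishes at most `m - 1` times, counting multiplicities up to `m`. -/
structure IsECSpace {p q : ℝ} (h : p < q) (m : ℕ) (U : Submodule ℝ (Icc p q → ℝ)) : Prop where
  one_le : 1 ≤ m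
  finrank_eq : Module.finrank ℝ U = m
  isCn : ∀ f ∈ U, IsCn h (m - 1) f
  zeros : ∀ f ∈ U, f ≠ 0 → zeroCount (Icc p q) m (VanishesTo h f) < m

/-! ### Piecewise functions -/

/-- A family of nondegenerate closed intervals. -/
structure IntervalFamily (ι : Type) where
  left : ι → ℝ
  right : ι → ℝ
  lt : ∀ i, left i < right i

namespace IntervalFamily

variable {ι : Type} (P : IntervalFamily ι)

/-- Piecewise functions: functions defined separately on each of the intervals, so that they have
two, possibly different, values `F(x⁻)` and `F(x⁺)` at a common endpoint `x` of two intervals. -/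
abbrev PFun : Type := ∀ i, Icc (P.left i) (P.right i) → ℝ

/-- The union of the intervals. -/
def carrier : Set ℝ := {t | ∃ i, t ∈ Icc (P.left i) (P.right i)}

/-- Piecewise `C^n` functions. -/
def IsPiecewiseCn (n : ℕ) (F : P.PFun) : Prop := ∀ i, IsCn (P.lt i) n (F i)

/-- `F` vanishes at least `r` times at `t`; if `t` is a common endpoint of two intervals, both at
`t⁻` and at `t⁺`. -/
def Vanishes (F : P.PFun) (t : ℝ) (r : ℕ) : Prop :=
  ∀ i, t ∈ Icc (P.left i) (P.right i) → VanishesTo (P.lt i) (F i) t r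

/-- The number `Z_n(F)` of zeros of `F`, counting multiplicities up to `n`. -/
def Z (n : ℕ) (F : P.PFun) : ℕ∞ := zeroCount P.carrier n (P.Vanishes F)

/-- The piecewise derivative. -/
def D (F : P.PFun) : P.PFun := fun i t => pieceDeriv (P.lt i) 1 (F i) t

/-- `V` is an `n`-dimensional Extended Chebyshev Piecewise space: an `n`-dimensional space of
piecewise `C^(n-1)` functions whose nonzero elements satisfy `Z_n(F) ≤ n - 1`. -/
structure IsECPSpace (n : ℕ) (V : Submodule ℝ P.PFun) : Prop where
  finiteDimensional : FiniteDimensional ℝ V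
  finrank_eq : Module.finrank ℝ V = n
  isCn : ∀ F ∈ V, P.IsPiecewiseCn (n - 1) F
  zeros : ∀ F ∈ V, F ≠ 0 → P.Z n F < n

/-- `B` (indexed from `0`) is a Bernstein-like basis on `[a, b]` of the `n`-dimensional space `V` of
piecewise functions on a partition `P` of `[a, b]`: `B ℓ` vanishes exactly `ℓ` times at `a`, exactly
`n - 1 - ℓ` times at `b`, and is positive on `(a, b)` (on both sides of the interior knots). -/
structure IsBernsteinLikeBasis (a b : ℝ) (n : ℕ) (V : Submodule ℝ P.PFun)
    (B : Fin n → P.PFun) : Prop where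
  linearIndependent : LinearIndependent ℝ B
  span_eq : Submodule.span ℝ (range B) = V
  zeros_left : ∀ l : Fin n, cappedMult n (P.Vanishes (B l) a) = l
  zeros_right : ∀ l : Fin n, cappedMult n (P.Vanishes (B l) b) = n - 1 - l
  pos : ∀ (l : Fin n) (i : ι) (t : Icc (P.left i) (P.right i)), a < t → t < b → 0 < B l i t

/-! ### Restriction to a subinterval -/

/-- The partition that `P` induces on `[c, d]`: all intersections of `[c, d]` with intervals of `P`
that are not empty and not reduced to a point. -/
def restrict {c d : ℝ} (hcd : c < d) :
    IntervalFamily {i : ι // P.left i < d ∧ c < P.right i} where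
  left i := max c (P.left i)
  right i := min d (P.right i)
  lt i := max_lt (lt_min hcd i.2.2) (lt_min i.2.1 (P.lt i))

/-- Restriction of piecewise functions to `[c, d]`. -/
def restrictFun {c d : ℝ} (hcd : c < d) : P.PFun →ₗ[ℝ] (P.restrict hcd).PFun where
  toFun F := fun i t =>
    F i ⟨t, (le_max_right c (P.left i)).trans t.2.1, t.2.2.trans (min_le_right d (P.right i))⟩
  map_add' _ _ := rfl
  map_smul' _ _ := rfl

end IntervalFamily

/-! ### Facts needed to see that the spaces below are vector spaces -/

section facts

variable {p q : ℝ} (h : p < q) {n r : ℕ} {f g : Icc p q → ℝ}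

theorem IsCn.add (hf : IsCn h n f) (hg : IsCn h n g) : IsCn h n (f + g) :=
  ContDiffOn.add (f := IccExtend h.le f) (g := IccExtend h.le g) hf hg

theorem IsCn.smul (a : ℝ) (hf : IsCn h n f) : IsCn h n (a • f) :=
  ContDiffOn.const_smul (f := IccExtend h.le f) a hf

theorem IsCn.zero : IsCn h n (0 : Icc p q → ℝ) :=
  (contDiffOn_const (c := (0 : ℝ)) : ContDiffOn ℝ n (fun _ : ℝ => (0 : ℝ)) (Icc p q))

theorem pieceDeriv_add (hf : IsCn h n f) (hg : IsCn h n g) (hr : r ≤ n) {t : ℝ}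
    (ht : t ∈ Icc p q) : pieceDeriv h r (f + g) t = pieceDeriv h r f t + pieceDeriv h r g t :=
  iteratedDerivWithin_add (f := IccExtend h.le f) (g := IccExtend h.le g) ht (uniqueDiffOn_Icc h)
    ((hf t ht).of_le (by exact_mod_cast hr)) ((hg t ht).of_le (by exact_mod_cast hr))

theorem pieceDeriv_smul (a : ℝ) (hf : IsCn h n f) (hr : r ≤ n) {t : ℝ} (ht : t ∈ Icc p q) :
    pieceDeriv h r (a • f) t = a * pieceDeriv h r f t :=
  iteratedDerivWithin_const_smul (f := IccExtend h.le f) ht (uniqueDiffOn_Icc h) a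
    ((hf t ht).of_le (by exact_mod_cast hr))

theorem pieceDeriv_zero (t : ℝ) : pieceDeriv h r (0 : Icc p q → ℝ) t = 0 := by
  have : IccExtend h.le (0 : Icc p q → ℝ) = fun _ => (0 : ℝ) := rfl
  simp [pieceDeriv, this]

end facts

/-- The space `DV = {DF | F ∈ V}`. (The demand that `F` be piecewise `C^1` is void when `V` consists
of piecewise `C^(m-1)` functions with `m ≥ 2`, and when `V` consists of constants.) -/
def IntervalFamily.derivSpace {ι : Type} (P : IntervalFamily ι) (V : Submodule ℝ P.PFun) :
    Submodule ℝ P.PFun where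
  carrier := {G | ∃ F ∈ V, P.IsPiecewiseCn 1 F ∧ P.D F = G}
  add_mem' := by
    rintro _ _ ⟨F, hF, hF1, rfl⟩ ⟨G, hG, hG1, rfl⟩
    refine ⟨F + G, V.add_mem hF hG, fun i => (hF1 i).add _ (hG1 i), ?_⟩
    funext i t
    exact pieceDeriv_add (P.lt i) (hF1 i) (hG1 i) le_rfl t.2
  zero_mem' := by
    refine ⟨0, V.zero_mem, fun i => IsCn.zero _, ?_⟩
    funext i t
    exact pieceDeriv_zero (P.lt i) _
  smul_mem' := by
    rintro a _ ⟨F, hF, hF1, rfl⟩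
    refine ⟨a • F, V.smul_mem a hF, fun i => (hF1 i).smul _ a, ?_⟩
    funext i t
    exact pieceDeriv_smul (P.lt i) a (hF1 i) le_rfl t.2

/-! ### Spline spaces with knots of zero multiplicity -/

/-- The partition `x 0 < x 1 < ⋯ < x (k + 1)` into the intervals `[x i, x (i + 1)]`, `0 ≤ i ≤ k`. -/
def knotPartition {k : ℕ} (x : Fin (k + 2) → ℝ) (hx : StrictMono x) :
    IntervalFamily (Fin (k + 1)) where
  left i := x i.castSucc
  right i := x i.succ
  lt i := hx i.castSucc_lt_succ

/-- `R` is lower triangular, has positive diagonal entries, and its first row and its first column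
are `(1, 0, …, 0)`. -/
structure IsConnectionMatrix {m : ℕ} (R : Matrix (Fin m) (Fin m) ℝ) : Prop where
  lower : ∀ i j, i < j → R i j = 0
  diag_pos : ∀ i, 0 < R i i
  first_row : ∀ i j : Fin m, (i : ℕ) = 0 → R i j = if j = i then 1 else 0
  first_col : ∀ i j : Fin m, (j : ℕ) = 0 → R i j = if i = j then 1 else 0

/-- The column `(D^0 f(t), …, D^(m-1) f(t))`. -/
def jet {p q : ℝ} (h : p < q) (m : ℕ) (f : Icc p q → ℝ) (t : ℝ) : Fin m → ℝ :=
  fun r => pieceDeriv h r f t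

/-- The spline space `S(U, Δ, R)` with knots of zero multiplicity: all piecewise `C^(m-1)` functions
`F` whose restriction to `[x i, x (i + 1)]` belongs to `U i` and whose left and right derivatives at
the interior knots `x 1, …, x k` are connected by the matrices `R 0, …, R (k - 1)`. -/
def splineSpace {k : ℕ} (m : ℕ) (x : Fin (k + 2) → ℝ) (hx : StrictMono x)
    (U : ∀ i : Fin (k + 1), Submodule ℝ (Icc (x i.castSucc) (x i.succ) → ℝ))
    (R : Fin k → Matrix (Fin m) (Fin m) ℝ) : Submodule ℝ (knotPartition x hx).PFun where
  carrier := {F | (knotPartition x hx).IsPiecewiseCn (m - 1) F ∧ (∀ i, F i ∈ U i) ∧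
    ∀ i : Fin k,
      jet ((knotPartition x hx).lt i.succ) m (F i.succ) (x i.succ.castSucc) =
        Matrix.mulVec (R i)
          (jet ((knotPartition x hx).lt i.castSucc) m (F i.castSucc) (x i.succ.castSucc))}
  add_mem' := by
    rintro F G ⟨hF, hFU, hFR⟩ ⟨hG, hGU, hGR⟩
    refine ⟨fun i => (hF i).add _ (hG i), fun i => (U i).add_mem (hFU i) (hGU i), fun i => ?_⟩
    have key : ∀ (j : Fin (k + 1)) (t : ℝ), t ∈ Icc (x j.castSucc) (x j.succ) →
        jet ((knotPartition x hx).lt j) m ((F + G) j) t =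
          jet ((knotPartition x hx).lt j) m (F j) t +
            jet ((knotPartition x hx).lt j) m (G j) t := by
      intro j t ht
      funext r
      exact pieceDeriv_add _ (hF j) (hG j) (Nat.le_sub_one_of_lt r.2) ht
    rw [key i.succ _ ⟨le_rfl, hx.monotone (Fin.castSucc_lt_succ (i := i.succ)).le⟩,
      key i.castSucc _ ⟨hx.monotone (by simp [Fin.le_def]), le_of_eq (by rw [Fin.succ_castSucc])⟩,
      Matrix.mulVec_add, hFR i, hGR i]
  zero_mem' := by
    refine ⟨fun i => IsCn.zero _, fun i => (U i).zero_mem, fun i => ?_⟩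
    have key : ∀ (j : Fin (k + 1)) (t : ℝ),
        jet ((knotPartition x hx).lt j) m ((0 : (knotPartition x hx).PFun) j) t = 0 := by
      intro j t
      funext r
      exact pieceDeriv_zero _ t
    rw [key, key, Matrix.mulVec_zero]
  smul_mem' := by
    rintro a F ⟨hF, hFU, hFR⟩
    refine ⟨fun i => (hF i).smul _ a, fun i => (U i).smul_mem a (hFU i), fun i => ?_⟩
    have key : ∀ (j : Fin (k + 1)) (t : ℝ), t ∈ Icc (x j.castSucc) (x j.succ) →
        jet ((knotPartition x hx).lt j) m ((a • F) j) t =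
          a • jet ((knotPartition x hx).lt j) m (F j) t := by
      intro j t ht
      funext r
      exact pieceDeriv_smul _ a (hF j) (Nat.le_sub_one_of_lt r.2) ht
    rw [key i.succ _ ⟨le_rfl, hx.monotone (Fin.castSucc_lt_succ (i := i.succ)).le⟩,
      key i.castSucc _ ⟨hx.monotone (by simp [Fin.le_def]), le_of_eq (by rw [Fin.succ_castSucc])⟩,
      Matrix.mulVec_smul, hFR i]

end

open Filter Topology

/-! ### Derivatives on one interval -/

section onePiece

variable {p q : ℝ} (h : p < q) {n r : ℕ} {f g : Icc p q → ℝ} {t : ℝ}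

/-! Let `n = m - 1` be the dimension of `DS`. Everything rests on one count: an element of `DS` with
`n` zeros is identically zero. Combined with linear algebra (fewer than `n` linear conditions have a
nonzero solution), it shows that functions with `n - 1` prescribed zeros exist, are unique up to
scale, and keep one sign between these zeros.

The interval is shrunk one end at a time, from `[a, b]` to `[a, d]` to `[c, d]`, by corner cutting.
Let `F` be positive between `p` and `q`, with `i` zeros at `p`, `j` at `q` and `k + 1` at an outside
point `t`, `n - 1` in all. Let `G` and `H` be positive functions obtained by moving one zero from
`t` to `q`, respectively to `p`. Matching the leading derivatives of `F` and `G` at `p`, and of `F`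
and `H` at `q`, yields `c, d > 0` such that `F - c • G - d • H` has `i + 1`, `j + 1` and `k` zeros,
so it is zero (`exists_eq_smul_add_smul`). Repeating this until no zero is left at `t` expands each
old basis function in the new basis with nonnegative coefficients, positive at the function with the
same number of zeros at `p` (`exists_nonneg_combination`). Hence positive combinations remain
positive combinations.

That `c` and `d` are positive is Taylor's formula, read on the piece on the correct side of the
point (`exists_pos_sub_vanishes`). Knots do no harm because the connection matrices preserve zeros
and signs of elements of `DS` (`isConnectedECPSpace_derivSpace`). -/

theorem VanishesTo.mono {s : ℕ} (hf : VanishesTo h f t r) (hs : s ≤ r) : VanishesTo h f t s :=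
  fun j hj => hf j (hj.trans_le hs)

theorem VanishesTo.succ (hf : VanishesTo h f t r) (hr : pieceDeriv h r f t = 0) :
    VanishesTo h f t (r + 1) := by
  intro j hj
  rcases Nat.lt_succ_iff_lt_or_eq.1 hj with hj | rfl
  exacts [hf j hj, hr]

theorem pieceDeriv_zero_order (ht : t ∈ Icc p q) : pieceDeriv h 0 f t = f ⟨t, ht⟩ := by
  simp [pieceDeriv, IccExtend_of_mem h.le f ht]

theorem vanishesTo_one_iff (ht : t ∈ Icc p q) : VanishesTo h f t 1 ↔ f ⟨t, ht⟩ = 0 := by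
  simp [VanishesTo, pieceDeriv_zero_order h ht]

/-- The derivatives of the derivative. -/
theorem pieceDeriv_pieceDeriv_one (ht : t ∈ Icc p q) :
    pieceDeriv h r (fun s : Icc p q => pieceDeriv h 1 f s) t = pieceDeriv h (r + 1) f t := by
  unfold pieceDeriv
  rw [iteratedDerivWithin_succ' (n := r)]
  refine iteratedDerivWithin_congr
    (f := IccExtend h.le fun s : Icc p q => iteratedDerivWithin 1 (IccExtend h.le f) (Icc p q) s)
    (fun s hs => ?_) ht
  rw [IccExtend_of_mem h.le _ hs, iteratedDerivWithin_one]

/-- The derivatives of the restriction to a smaller interval. -/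
theorem pieceDeriv_restrict {p' q' : ℝ} (h' : p' < q') (hp : p ≤ p') (hq : q' ≤ q)
    (hf : IsCn h n f) (hr : r ≤ n) (ht : t ∈ Icc p' q') :
    pieceDeriv h' r (fun s : Icc p' q' => f ⟨s, hp.trans s.2.1, s.2.2.trans hq⟩) t =
      pieceDeriv h r f t := by
  have hsub : Icc p' q' ⊆ Icc p q := Icc_subset_Icc hp hq
  unfold pieceDeriv
  rw [iteratedDerivWithin_congr (g := IccExtend h.le f) (fun s hs => ?_) ht,
    iteratedDerivWithin_eq_iteratedFDerivWithin, iteratedDerivWithin_eq_iteratedFDerivWithin,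
    iteratedFDerivWithin_subset hsub (uniqueDiffOn_Icc h') (uniqueDiffOn_Icc h)
      (ContDiffOn.of_le hf (by exact_mod_cast hr)) ht]
  rw [IccExtend_of_mem h'.le _ hs, IccExtend_of_mem h.le _ (hsub hs)]

/-- Taylor's formula at a point where the derivatives of order less than `r` vanish. -/
theorem tendsto_div_pow_of_vanishesTo (hf : IsCn h n f) (hr : r ≤ n) (ht : t ∈ Icc p q)
    (hv : VanishesTo h f t r) :
    Tendsto (fun s => IccExtend h.le f s / (s - t) ^ r) (𝓝[Icc p q \ {t}] t)
      (𝓝 ((r.factorial : ℝ)⁻¹ * pieceDeriv h r f t)) := by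
  have hlo := taylor_isLittleO (convex_Icc p q) ht
    (ContDiffOn.of_le hf (by exact_mod_cast hr) : ContDiffOn ℝ r (IccExtend h.le f) (Icc p q))
  have hev : ∀ s, taylorWithinEval (IccExtend h.le f) r (Icc p q) t s =
      ((r.factorial : ℝ)⁻¹ * (s - t) ^ r) * pieceDeriv h r f t := by
    intro s
    rw [taylor_within_apply, Finset.sum_range_succ, Finset.sum_eq_zero, zero_add, smul_eq_mul]
    · rfl
    · intro j hj
      rw [show iteratedDerivWithin j (IccExtend h.le f) (Icc p q) t = 0 from
        hv j (Finset.mem_range.1 hj), smul_zero]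
  have h1 := (hlo.mono (nhdsWithin_mono t (sdiff_subset (t := {t})))).tendsto_div_nhds_zero
  have h2 := h1.add_const ((r.factorial : ℝ)⁻¹ * pieceDeriv h r f t)
  rw [zero_add] at h2
  refine h2.congr' ?_
  filter_upwards [self_mem_nhdsWithin] with s hs
  have : s - t ≠ 0 := sub_ne_zero.2 hs.2
  rw [hev]
  field_simp
  ring

/-- Two functions with a common sign near one side of `t` and a zero of the same order `r` at `t`
have `r`-th derivatives of the same sign. -/
theorem pieceDeriv_mul_nonneg (hf : IsCn h n f) (hg : IsCn h n g) (hr : r ≤ n) {A : Set ℝ}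
    (hA : A ⊆ Icc p q) (htA : t ∉ A) (ht : t ∈ closure A)
    (hpos : ∀ s ∈ A, 0 ≤ IccExtend h.le f s * IccExtend h.le g s)
    (hfv : VanishesTo h f t r) (hgv : VanishesTo h g t r) :
    0 ≤ pieceDeriv h r f t * pieceDeriv h r g t := by
  have htI : t ∈ Icc p q := closure_minimal hA isClosed_Icc ht
  have hle : 𝓝[A] t ≤ 𝓝[Icc p q \ {t}] t :=
    nhdsWithin_mono t fun s hs => ⟨hA hs, fun hst => htA (hst ▸ hs)⟩
  have := mem_closure_iff_nhdsWithin_neBot.1 ht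
  have hlim := ((tendsto_div_pow_of_vanishesTo h hf hr htI hfv).mono_left hle).mul
    ((tendsto_div_pow_of_vanishesTo h hg hr htI hgv).mono_left hle)
  have h0 := ge_of_tendsto hlim (b := 0) <| by
    filter_upwards [self_mem_nhdsWithin] with s hs
    -- The denominator becomes the square of `(s - t) ^ r`, so the side of `t` on which `A` lies is
    -- irrelevant.
    rw [div_mul_div_comm]
    exact div_nonneg (hpos s hs) (mul_self_nonneg _)
  have hfac : (0 : ℝ) < (r.factorial : ℝ)⁻¹ := by positivity
  rw [mul_mul_mul_comm] at h0
  exact nonneg_of_mul_nonneg_right h0 (mul_pos hfac hfac)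

end onePiece

/-! ### ECP-spaces whose zeros and signs agree across the knots -/

namespace IntervalFamily

variable {ι : Type} (P : IntervalFamily ι)

/-- An ECP-space of dimension `n` on a partition of `[a, b]` into finitely many intervals, such that
the zeros of order at most `n` and the signs of its elements agree on both sides of the knots. -/
structure IsConnectedECPSpace (a b : ℝ) (n : ℕ) (V : Submodule ℝ P.PFun) : Prop where
  finite : Finite ι
  carrier_eq : P.carrier = Icc a b
  ecp : P.IsECPSpace n V
  vanishesTo : ∀ F ∈ V, ∀ i j t, t ∈ Icc (P.left i) (P.right i) → t ∈ Icc (P.left j) (P.right j) →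
    ∀ r ≤ n, VanishesTo (P.lt i) (F i) t r → VanishesTo (P.lt j) (F j) t r
  pos : ∀ F ∈ V, ∀ i j t (hi : t ∈ Icc (P.left i) (P.right i))
    (hj : t ∈ Icc (P.left j) (P.right j)), 0 < F i ⟨t, hi⟩ → 0 < F j ⟨t, hj⟩

/-- `F` is positive strictly between `p` and `q`, on both sides of the knots. -/
def PosBetween (F : P.PFun) (p q : ℝ) : Prop :=
  ∀ i (t : Icc (P.left i) (P.right i)), (t : ℝ) ∈ uIoo p q → 0 < F i t

variable {P}

theorem Vanishes.mono {F : P.PFun} {t : ℝ} {r s : ℕ} (hF : P.Vanishes F t r) (hs : s ≤ r) :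
    P.Vanishes F t s := fun i hi => (hF i hi).mono _ hs

theorem vanishes_zero_order (F : P.PFun) (t : ℝ) : P.Vanishes F t 0 :=
  fun _ _ j hj => absurd hj (Nat.not_lt_zero j)

/-- Vanishing to order `r` is downward closed in `r`, so the greatest order is detected by its
immediate successor alone. -/
theorem cappedMult_eq_iff {n l : ℕ} {F : P.PFun} {t : ℝ} :
    cappedMult n (P.Vanishes F t) = l ↔
      l ≤ n ∧ P.Vanishes F t l ∧ (l < n → ¬ P.Vanishes F t (l + 1)) := by
  classical
  unfold cappedMult
  rw [Nat.findGreatest_eq_iff]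
  refine and_congr_right fun hl => and_congr ⟨fun h => ?_, fun h _ => h⟩
    ⟨fun h hn => h (Nat.lt_succ_self l) hn, fun h j hj hjn hv => h (by omega) (hv.mono hj)⟩
  rcases eq_or_ne l 0 with rfl | h0
  exacts [vanishes_zero_order F t, h h0]

theorem le_cappedMult {n r : ℕ} {F : P.PFun} {t : ℝ} (hr : r ≤ n) (hF : P.Vanishes F t r) :
    r ≤ cappedMult n (P.Vanishes F t) := by
  classical
  exact Nat.le_findGreatest hr hF

namespace IsConnectedECPSpace

variable {a b : ℝ} {n : ℕ} {V : Submodule ℝ P.PFun} (hV : P.IsConnectedECPSpace a b n V)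
include hV

theorem exists_piece {t : ℝ} (ht : t ∈ Icc a b) : ∃ i, t ∈ Icc (P.left i) (P.right i) :=
  (hV.carrier_eq.symm ▸ ht : t ∈ P.carrier)

/-- Some piece accumulates at `t` inside a given set of which `t` is a limit. -/
theorem exists_piece_closure {A : Set ℝ} (hA : A ⊆ Icc a b) {t : ℝ} (ht : t ∈ closure A) :
    ∃ i, t ∈ closure (Icc (P.left i) (P.right i) ∩ A) := by
  have := hV.finite
  have : A = ⋃ i, Icc (P.left i) (P.right i) ∩ A := by
    rw [← iUnion_inter, inter_eq_right.2]
    intro s hs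
    exact mem_iUnion.2 (hV.exists_piece (hA hs))
  rw [this, closure_iUnion_of_finite] at ht
  exact mem_iUnion.1 ht

theorem vanishes_of_vanishesTo {F : P.PFun} (hF : F ∈ V) {t : ℝ} {i : ι}
    (hi : t ∈ Icc (P.left i) (P.right i)) {r : ℕ} (hr : r ≤ n)
    (h : VanishesTo (P.lt i) (F i) t r) : P.Vanishes F t r :=
  fun j hj => hV.vanishesTo F hF i j t hi hj r hr h

theorem vanishes_sub_smul {F G : P.PFun} (hF : F ∈ V) (hG : G ∈ V) {t : ℝ} {r : ℕ} (hr : r ≤ n)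
    (hFv : P.Vanishes F t r) (hGv : P.Vanishes G t r) (c : ℝ) : P.Vanishes (F - c • G) t r := by
  intro i hi j hj
  have hj' : j ≤ n - 1 := by omega
  have := pieceDeriv_add (P.lt i) (hV.ecp.isCn F hF i)
    ((hV.ecp.isCn G hG i).smul (P.lt i) (-c)) hj' hi
  rw [pieceDeriv_smul (P.lt i) (-c) (hV.ecp.isCn G hG i) hj' hi, hFv i hi j hj, hGv i hi j hj] at this
  rw [sub_eq_add_neg, ← neg_smul]
  simpa using this

theorem vanishes_sum {κ : Type*} (s : Finset κ) {F : κ → P.PFun} (c : κ → ℝ) {t : ℝ} {r : ℕ}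
    (hr : r ≤ n) (hF : ∀ l ∈ s, F l ∈ V) (hFv : ∀ l ∈ s, P.Vanishes (F l) t r) :
    P.Vanishes (∑ l ∈ s, c l • F l) t r := by
  classical
  induction s using Finset.induction_on with
  | empty =>
    intro i _ j _
    simpa using pieceDeriv_zero (P.lt i) t
  | insert l s hl ih =>
    rw [Finset.sum_insert hl, add_comm]
    have := hV.vanishes_sub_smul
      (V.sum_mem fun k hk => V.smul_mem (c k) (hF k (Finset.mem_insert_of_mem hk)))
      (hF l (Finset.mem_insert_self l s)) hr
      (ih (fun k hk => hF k (Finset.mem_insert_of_mem hk))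
        fun k hk => hFv k (Finset.mem_insert_of_mem hk))
      (hFv l (Finset.mem_insert_self l s)) (-c l)
    simpa using this

/-! ### Counting zeros: existence, sign and uniqueness -/

/-- An element with `n` zeros is zero. -/
theorem eq_zero_of_vanishes {κ : Type*} [Fintype κ] (p : κ → ℝ) (hp : Function.Injective p)
    (hpab : ∀ l, p l ∈ Icc a b) (μ : κ → ℕ) (hμn : ∀ l, μ l ≤ n) (hμ : n ≤ ∑ l, μ l)
    {F : P.PFun} (hF : F ∈ V) (hv : ∀ l, P.Vanishes F (p l) (μ l)) : F = 0 := by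
  by_contra h0
  have hlt := hV.ecp.zeros F hF h0
  refine absurd hlt (not_lt.2 ?_)
  let T : {T : Finset ℝ // (T : Set ℝ) ⊆ P.carrier} :=
    ⟨Finset.univ.map ⟨p, hp⟩, by
      rw [hV.carrier_eq]
      intro t ht
      simp only [Finset.coe_map, Function.Embedding.coeFn_mk, Finset.coe_univ, image_univ,
        mem_range] at ht
      obtain ⟨l, rfl⟩ := ht
      exact hpab l⟩
  refine le_trans ?_ (le_iSup (fun T : {T : Finset ℝ // (T : Set ℝ) ⊆ P.carrier} =>
    ((∑ t ∈ T.1, cappedMult n (P.Vanishes F t) : ℕ) : ℕ∞)) T)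
  have : n ≤ ∑ t ∈ T.1, cappedMult n (P.Vanishes F t) := by
    refine hμ.trans ?_
    simp only [T, Finset.sum_map, Function.Embedding.coeFn_mk]
    exact Finset.sum_le_sum fun l _ => le_cappedMult (hμn l) (hv l)
  exact_mod_cast this

/-- There is a nonzero element with `n - 1` prescribed zeros. -/
theorem exists_vanishes {κ : Type} [Fintype κ] (p : κ → ℝ)
    (hpab : ∀ l, p l ∈ Icc a b) (μ : κ → ℕ) (hμ : ∑ l, μ l < n) :
    ∃ F ∈ V, F ≠ 0 ∧ ∀ l, P.Vanishes F (p l) (μ l) := by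
  have := hV.ecp.finiteDimensional
  have hμl : ∀ l, μ l < n := fun l =>
    (Finset.single_le_sum (fun _ _ => Nat.zero_le _) (Finset.mem_univ l)).trans_lt hμ
  choose i hi using fun l => hV.exists_piece (hpab l)
  let Φ : V →ₗ[ℝ] ((Σ l, Fin (μ l)) → ℝ) :=
    { toFun := fun F s => pieceDeriv (P.lt (i s.1)) s.2 (F.1 (i s.1)) (p s.1)
      map_add' := by
        intro F G
        funext s
        have := hμl s.1
        exact pieceDeriv_add _ (hV.ecp.isCn F.1 F.2 _) (hV.ecp.isCn G.1 G.2 _)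
          (by have := s.2.2; omega) (hi s.1)
      map_smul' := by
        intro c F
        funext s
        have := hμl s.1
        exact pieceDeriv_smul _ c (hV.ecp.isCn F.1 F.2 _) (by have := s.2.2; omega) (hi s.1) }
  -- There are fewer than `n` conditions on an `n`-dimensional space. Each is imposed on one chosen
  -- piece only; agreement across knots carries it to the other side.
  have hker : Φ.ker ≠ ⊥ := LinearMap.ker_ne_bot_of_finrank_lt (by
    rw [hV.ecp.finrank_eq, Module.finrank_fintype_fun_eq_card, Fintype.card_sigma]
    simpa using hμ)
  obtain ⟨F, hF, hF0⟩ := Submodule.exists_mem_ne_zero_of_ne_bot hker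
  refine ⟨F.1, F.2, fun h => hF0 (Subtype.ext h), fun l => ?_⟩
  refine hV.vanishes_of_vanishesTo F.2 (hi l) (hμl l).le fun j hj => ?_
  exact congrFun (LinearMap.mem_ker.1 hF) ⟨l, j, hj⟩

/-- An element without zeros between `p` and `q` is positive there, up to the sign. -/
theorem posBetween_or_neg {F : P.PFun} (hF : F ∈ V) (hn : n ≠ 0) {p q : ℝ} (hp : p ∈ Icc a b)
    (hq : q ∈ Icc a b) (h0 : ∀ t ∈ uIoo p q, ¬ P.Vanishes F t 1) :
    P.PosBetween F p q ∨ P.PosBetween (-F) p q := by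
  have hfin := hV.finite
  have hne : ∀ i (t : Icc (P.left i) (P.right i)), (t : ℝ) ∈ uIoo p q → F i t ≠ 0 :=
    fun i t ht h => h0 t ht (hV.vanishes_of_vanishesTo hF t.2 (Nat.one_le_iff_ne_zero.2 hn)
      ((vanishesTo_one_iff (P.lt i) t.2).2 h))
  have hcont : ∀ i, ContinuousOn (IccExtend (P.lt i).le (F i)) (Icc (P.left i) (P.right i)) :=
    fun i => (hV.ecp.isCn F hF i).continuousOn
  by_contra! hcon
  obtain ⟨h1, h2⟩ := hcon
  unfold PosBetween at h1 h2
  push Not at h1 h2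
  obtain ⟨i, s, hs, hFs⟩ := h1
  obtain ⟨j, t, ht, hFt⟩ := h2
  -- If both signs occurred, connectedness would give a point where some piece is `≤ 0` and some
  -- piece is `≥ 0`. Neither value is zero, so the two pieces would have opposite signs there.
  have hN : IsClosed (⋃ i, Icc (P.left i) (P.right i) ∩
      IccExtend (P.lt i).le (F i) ⁻¹' Iic 0) :=
    isClosed_iUnion_of_finite fun i => (hcont i).preimage_isClosed_of_isClosed isClosed_Icc
      isClosed_Iic
  have hP : IsClosed (⋃ i, Icc (P.left i) (P.right i) ∩
      IccExtend (P.lt i).le (F i) ⁻¹' Ici 0) :=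
    isClosed_iUnion_of_finite fun i => (hcont i).preimage_isClosed_of_isClosed isClosed_Icc
      isClosed_Ici
  obtain ⟨u, hu, huN, huP⟩ := isPreconnected_closed_iff.1 (isPreconnected_uIoo (a := p) (b := q))
    _ _ hN hP (fun u hu => by
      obtain ⟨k, hk⟩ := hV.exists_piece ((ordConnected_Icc (a := a) (b := b)).uIcc_subset hp hq
        (uIoo_subset_uIcc_self hu))
      rcases le_total (IccExtend (P.lt k).le (F k) u) 0 with h | h
      · exact Or.inl (mem_iUnion.2 ⟨k, hk, h⟩)
      · exact Or.inr (mem_iUnion.2 ⟨k, hk, h⟩))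
    ⟨s, hs, mem_iUnion.2 ⟨i, s.2, by simpa [IccExtend_of_mem _ _ s.2] using hFs⟩⟩
    ⟨t, ht, mem_iUnion.2 ⟨j, t.2, by simpa [IccExtend_of_mem _ _ t.2] using hFt⟩⟩
  obtain ⟨i', hi', hiN⟩ := mem_iUnion.1 huN
  obtain ⟨j', hj', hjP⟩ := mem_iUnion.1 huP
  rw [mem_preimage, IccExtend_of_mem _ _ hi'] at hiN
  rw [mem_preimage, IccExtend_of_mem _ _ hj'] at hjP
  have hpos : 0 < F j' ⟨u, hj'⟩ := lt_of_le_of_ne hjP (hne j' ⟨u, hj'⟩ hu).symm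
  exact absurd (hV.pos F hF j' i' u hj' hi' hpos) (not_lt.2 hiN)

/-- The leading derivatives of two positive elements can be matched by a positive factor. -/
theorem exists_pos_sub_vanishes {F G : P.PFun} (hF : F ∈ V) (hG : G ∈ V) {p q : ℝ}
    (hp : p ∈ Icc a b) (hq : q ∈ Icc a b) (hpq : p ≠ q) (hFpos : P.PosBetween F p q)
    (hGpos : P.PosBetween G p q) {r : ℕ} (hr : r < n) (hFv : P.Vanishes F p r)
    (hGv : P.Vanishes G p r) (hFv' : ¬ P.Vanishes F p (r + 1))
    (hGv' : ¬ P.Vanishes G p (r + 1)) :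
    ∃ c : ℝ, 0 < c ∧ P.Vanishes (F - c • G) p (r + 1) := by
  have hsub : uIoo p q ⊆ Icc a b :=
    uIoo_subset_uIcc_self.trans ((ordConnected_Icc (a := a) (b := b)).uIcc_subset hp hq)
  -- Since `p` may be a knot, the piece is taken on the side of `p` facing `q`, where both functions
  -- are known to be positive.
  obtain ⟨i, hi⟩ := hV.exists_piece_closure hsub (t := p)
    (by rw [closure_uIoo hpq]; exact left_mem_uIcc)
  have hpi : p ∈ Icc (P.left i) (P.right i) :=
    closure_minimal inter_subset_left isClosed_Icc hi
  have hr' : r ≤ n - 1 := by omega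
  have hFi := hV.ecp.isCn F hF i
  have hGi := hV.ecp.isCn G hG i
  have hnn := pieceDeriv_mul_nonneg (P.lt i) hFi hGi hr' inter_subset_left
    (fun h => left_notMem_uIoo h.2) hi
    (fun s hs => by
      rw [IccExtend_of_mem _ _ hs.1, IccExtend_of_mem _ _ hs.1]
      exact (mul_pos (hFpos i ⟨s, hs.1⟩ hs.2) (hGpos i ⟨s, hs.1⟩ hs.2)).le)
    (hFv i hpi) (hGv i hpi)
  have hF0 : pieceDeriv (P.lt i) r (F i) p ≠ 0 := fun h =>
    hFv' (hV.vanishes_of_vanishesTo hF hpi hr ((hFv i hpi).succ _ h))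
  have hG0 : pieceDeriv (P.lt i) r (G i) p ≠ 0 := fun h =>
    hGv' (hV.vanishes_of_vanishesTo hG hpi hr ((hGv i hpi).succ _ h))
  set u := pieceDeriv (P.lt i) r (F i) p with hu
  set v := pieceDeriv (P.lt i) r (G i) p with hv
  have hpos : 0 < u * v := lt_of_le_of_ne hnn (mul_ne_zero hF0 hG0).symm
  refine ⟨u / v, ?_, ?_⟩
  · rw [← mul_div_mul_right u v hG0]
    exact div_pos hpos (mul_self_pos.2 hG0)
  · refine hV.vanishes_of_vanishesTo (V.sub_mem hF (V.smul_mem _ hG)) hpi hr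
      ((hV.vanishes_sub_smul hF hG hr.le hFv hGv _ i hpi).succ _ ?_)
    have := pieceDeriv_add (P.lt i) hFi (hGi.smul (P.lt i) (-(u / v))) hr' hpi
    rw [pieceDeriv_smul (P.lt i) _ hGi hr' hpi, ← hu, ← hv] at this
    rw [sub_eq_add_neg, ← neg_smul]
    refine this.trans ?_
    field_simp
    ring

theorem ne_zero_of_posBetween {F : P.PFun} {p q : ℝ} (hp : p ∈ Icc a b) (hq : q ∈ Icc a b)
    (hpq : p ≠ q) (hF : P.PosBetween F p q) : F ≠ 0 := by
  rintro rfl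
  obtain ⟨t, ht⟩ := (isConnected_uIoo hpq).nonempty
  obtain ⟨i, hi⟩ := hV.exists_piece ((ordConnected_Icc (a := a) (b := b)).uIcc_subset hp hq
    (uIoo_subset_uIcc_self ht))
  exact lt_irrefl _ (hF i ⟨t, hi⟩ ht)

/-- The zero bound at two points. It makes prescribed multiplicities exact: one more zero would
bring the total to `n`. -/
theorem not_vanishes_two {F : P.PFun} (hF : F ∈ V) (h0 : F ≠ 0) {p q : ℝ}
    (hp : p ∈ Icc a b) (hq : q ∈ Icc a b) (hpq : p ≠ q) {i j : ℕ} (hij : i + j = n)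
    (hpi : P.Vanishes F p i) (hqj : P.Vanishes F q j) : False := by
  refine h0 (hV.eq_zero_of_vanishes ![p, q] ?_ ?_ ![i, j] ?_ ?_ hF ?_)
  · intro k l
    fin_cases k <;> fin_cases l <;> simp [hpq, hpq.symm]
  · intro l; fin_cases l <;> simpa
  · intro l; fin_cases l <;> simp <;> omega
  · simp [hij]
  · intro l; fin_cases l <;> simpa

theorem not_vanishes_three {F : P.PFun} (hF : F ∈ V) (h0 : F ≠ 0) {p q t : ℝ}
    (hp : p ∈ Icc a b) (hq : q ∈ Icc a b) (ht : t ∈ Icc a b) (hpq : p ≠ q) (hpt : p ≠ t)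
    (hqt : q ≠ t) {i j k : ℕ} (hijk : i + j + k = n)
    (hpi : P.Vanishes F p i) (hqj : P.Vanishes F q j) (htk : P.Vanishes F t k) : False := by
  refine h0 (hV.eq_zero_of_vanishes ![p, q, t] ?_ ?_ ![i, j, k] ?_ ?_ hF ?_)
  · intro k l
    fin_cases k <;> fin_cases l <;> simp [hpq, hpq.symm, hpt, hpt.symm, hqt, hqt.symm]
  · intro l; fin_cases l <;> simpa
  · intro l; fin_cases l <;> simp <;> omega
  · simp [Fin.sum_univ_three, hijk]
  · intro l; fin_cases l <;> simpa

/-- There is an element, positive between `p` and `q`, with `n - 1` zeros prescribed at three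
points, the third of which is not between `p` and `q`. -/
theorem exists_posBetween_three {p q t : ℝ} (hp : p ∈ Icc a b) (hq : q ∈ Icc a b)
    (ht : t ∈ Icc a b) (hpq : p ≠ q) (hpt : p ≠ t) (hqt : q ≠ t) (htpq : t ∉ uIoo p q)
    {i j k : ℕ} (hijk : i + j + k + 1 = n) :
    ∃ F ∈ V, P.PosBetween F p q ∧ P.Vanishes F p i ∧ P.Vanishes F q j ∧ P.Vanishes F t k := by
  obtain ⟨F, hF, hF0, hv⟩ := hV.exists_vanishes ![p, q, t]
    (by intro l; fin_cases l <;> simpa) ![i, j, k] (by simp [Fin.sum_univ_three]; omega)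
  have hi : P.Vanishes F p i := hv 0
  have hj : P.Vanishes F q j := hv 1
  have hk : P.Vanishes F t k := hv 2
  have hsub : uIoo p q ⊆ Icc a b :=
    uIoo_subset_uIcc_self.trans ((ordConnected_Icc (a := a) (b := b)).uIcc_subset hp hq)
  -- A further zero `s` between `p` and `q` would be the `n`-th; `htpq` ensures that it differs from
  -- `t`.
  rcases hV.posBetween_or_neg hF (by omega) hp hq (fun s hs hs1 => by
    have hsp : p ≠ s := fun h => left_notMem_uIoo (h ▸ hs)
    have hsq : q ≠ s := fun h => right_notMem_uIoo (h ▸ hs)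
    have hst : t ≠ s := fun h => htpq (h ▸ hs)
    refine hF0 (hV.eq_zero_of_vanishes ![p, q, t, s] ?_ ?_ ![i, j, k, 1] ?_ ?_ hF ?_)
    · intro k l
      fin_cases k <;> fin_cases l <;>
        simp [hpq, hpq.symm, hpt, hpt.symm, hqt, hqt.symm, hsp, hsp.symm, hsq, hsq.symm, hst,
          hst.symm]
    · have := hsub hs
      intro l; fin_cases l <;> simpa
    · intro l; fin_cases l <;> simp <;> omega
    · simp [Fin.sum_univ_four]; omega
    · intro l; fin_cases l <;> simpa) with h | h
  · exact ⟨F, hF, h, hi, hj, hk⟩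
  · have key : ∀ {s r}, r ≤ n → P.Vanishes F s r → P.Vanishes (-F) s r := by
      intro s r hr hs
      -- Here `-F` is written as `F - 2 • F`.
      have := hV.vanishes_sub_smul hF hF hr hs hs 2
      rwa [two_smul, sub_add_cancel_left] at this
    exact ⟨-F, V.neg_mem hF, h, key (by omega) hi, key (by omega) hj, key (by omega) hk⟩

/-- There is an element, positive between `p` and `q`, with `n - 1` zeros prescribed at `p` and
`q`. -/
theorem exists_posBetween_two {p q : ℝ} (hp : p ∈ Icc a b) (hq : q ∈ Icc a b) (hpq : p ≠ q)
    {i j : ℕ} (hij : i + j + 1 = n) :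
    ∃ F ∈ V, P.PosBetween F p q ∧ P.Vanishes F p i ∧ P.Vanishes F q j := by
  obtain ⟨F, hF, hF0, hv⟩ := hV.exists_vanishes ![p, q]
    (by intro l; fin_cases l <;> simpa) ![i, j] (by simp; omega)
  have hi : P.Vanishes F p i := hv 0
  have hj : P.Vanishes F q j := hv 1
  have hsub : uIoo p q ⊆ Icc a b :=
    uIoo_subset_uIcc_self.trans ((ordConnected_Icc (a := a) (b := b)).uIcc_subset hp hq)
  rcases hV.posBetween_or_neg hF (by omega) hp hq (fun s hs hs1 =>
    hV.not_vanishes_three hF hF0 hp hq (hsub hs) hpq (fun h => left_notMem_uIoo (h ▸ hs))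
      (fun h => right_notMem_uIoo (h ▸ hs)) hij hi hj hs1) with h | h
  · exact ⟨F, hF, h, hi, hj⟩
  · have key : ∀ {s r}, r ≤ n → P.Vanishes F s r → P.Vanishes (-F) s r := by
      intro s r hr hs
      have := hV.vanishes_sub_smul hF hF hr hs hs 2
      rwa [two_smul, sub_add_cancel_left] at this
    exact ⟨-F, V.neg_mem hF, h, key (by omega) hi, key (by omega) hj⟩

/-- Two elements, positive between `p` and `q`, with the same `n - 1` zeros at `p` and `q` are
proportional. -/
theorem exists_eq_smul {F G : P.PFun} (hF : F ∈ V) (hG : G ∈ V) {p q : ℝ} (hp : p ∈ Icc a b)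
    (hq : q ∈ Icc a b) (hpq : p ≠ q) (hFpos : P.PosBetween F p q) (hGpos : P.PosBetween G p q)
    {i j : ℕ} (hij : i + j + 1 = n) (hFp : P.Vanishes F p i) (hFq : P.Vanishes F q j)
    (hGp : P.Vanishes G p i) (hGq : P.Vanishes G q j) : ∃ c : ℝ, 0 < c ∧ F = c • G := by
  have hF0 := hV.ne_zero_of_posBetween hp hq hpq hFpos
  have hG0 := hV.ne_zero_of_posBetween hp hq hpq hGpos
  obtain ⟨c, hc, h⟩ := hV.exists_pos_sub_vanishes hF hG hp hq hpq hFpos hGpos (by omega) hFp hGp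
    (fun h => hV.not_vanishes_two hF hF0 hp hq hpq (by omega) h hFq)
    (fun h => hV.not_vanishes_two hG hG0 hp hq hpq (by omega) h hGq)
  refine ⟨c, hc, sub_eq_zero.1 ?_⟩
  by_contra h0
  exact hV.not_vanishes_two (V.sub_mem hF (V.smul_mem c hG)) h0 hp hq hpq (by omega) h
    (hV.vanishes_sub_smul hF hG (by omega) hFq hGq c)

/-! ### Corner cutting -/

/-- One step of corner cutting: a zero at `t` is traded for a zero at `p` or at `q`. -/
theorem exists_eq_smul_add_smul {F G H : P.PFun} (hF : F ∈ V) (hG : G ∈ V) (hH : H ∈ V)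
    {p q t : ℝ} (hp : p ∈ Icc a b) (hq : q ∈ Icc a b) (ht : t ∈ Icc a b) (hpq : p ≠ q)
    (hpt : p ≠ t) (hqt : q ≠ t) (hFpos : P.PosBetween F p q) (hGpos : P.PosBetween G p q)
    (hHpos : P.PosBetween H p q) {i j k : ℕ} (hijk : i + j + (k + 1) + 1 = n)
    (hFp : P.Vanishes F p i) (hFq : P.Vanishes F q j) (hFt : P.Vanishes F t (k + 1))
    (hGp : P.Vanishes G p i) (hGq : P.Vanishes G q (j + 1)) (hGt : P.Vanishes G t k)
    (hHp : P.Vanishes H p (i + 1)) (hHq : P.Vanishes H q j) (hHt : P.Vanishes H t k) :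
    ∃ c d : ℝ, 0 < c ∧ 0 < d ∧ F = c • G + d • H := by
  have hF0 := hV.ne_zero_of_posBetween hp hq hpq hFpos
  have hG0 := hV.ne_zero_of_posBetween hp hq hpq hGpos
  have hH0 := hV.ne_zero_of_posBetween hp hq hpq hHpos
  obtain ⟨c, hc, hcv⟩ := hV.exists_pos_sub_vanishes hF hG hp hq hpq hFpos hGpos (by omega) hFp hGp
    (fun h => hV.not_vanishes_three hF hF0 hp hq ht hpq hpt hqt (by omega) h hFq hFt)
    (fun h => hV.not_vanishes_three hG hG0 hp hq ht hpq hpt hqt (by omega) h hGq hGt)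
  have hFpos' : P.PosBetween F q p := by unfold PosBetween; rwa [uIoo_comm]
  have hHpos' : P.PosBetween H q p := by unfold PosBetween; rwa [uIoo_comm]
  obtain ⟨d, hd, hdv⟩ := hV.exists_pos_sub_vanishes hF hH hq hp hpq.symm hFpos' hHpos' (by omega)
    hFq hHq
    (fun h => hV.not_vanishes_three hF hF0 hp hq ht hpq hpt hqt (by omega) hFp h hFt)
    (fun h => hV.not_vanishes_three hH hH0 hp hq ht hpq hpt hqt (by omega) hHp h hHt)
  refine ⟨c, d, hc, hd, sub_eq_zero.1 ?_⟩
  have hFG := V.sub_mem hF (V.smul_mem c hG)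
  have hFH := V.sub_mem hF (V.smul_mem d hH)
  -- The difference has `i + 1`, `j + 1` and `k` zeros, `n` in all. The extra zero at `p` comes from
  -- `F - c • G`, the one at `q` from `F - d • H`, so the order of subtraction is exchanged for the
  -- latter.
  rw [← sub_sub]
  by_contra h0
  refine hV.not_vanishes_three (V.sub_mem hFG (V.smul_mem d hH)) h0 hp hq ht hpq hpt hqt
    (by omega : i + 1 + (j + 1) + k = n) (hV.vanishes_sub_smul hFG hH (by omega) hcv hHp d) ?_
    (hV.vanishes_sub_smul hFG hH (by omega)
      (hV.vanishes_sub_smul hF hG (by omega) (hFt.mono (by omega)) hGt c) hHt d)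
  rw [sub_right_comm]
  exact hV.vanishes_sub_smul hFH hG (by omega) hdv hGq c

/-- Corner cutting. -/
theorem exists_nonneg_combination {p q t : ℝ} (hp : p ∈ Icc a b) (hq : q ∈ Icc a b)
    (ht : t ∈ Icc a b) (hpq : p ≠ q) (hpt : p ≠ t) (hqt : q ≠ t) (htpq : t ∉ uIoo p q)
    {E : Fin n → P.PFun} (hE : ∀ l, E l ∈ V) (hEpos : ∀ l, P.PosBetween (E l) p q)
    (hEp : ∀ l, P.Vanishes (E l) p l) (hEq : ∀ l, P.Vanishes (E l) q (n - 1 - l)) (k : ℕ) :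
    ∀ (i : Fin n) (j : ℕ), i + j + k + 1 = n → ∀ F ∈ V, P.PosBetween F p q → P.Vanishes F p i →
      P.Vanishes F q j → P.Vanishes F t k →
      ∃ c : Fin n → ℝ, (∀ l, 0 ≤ c l) ∧ 0 < c i ∧ F = ∑ l, c l • E l := by
  induction k with
  | zero =>
    intro i j hij F hF hFpos hFp hFq _
    obtain ⟨c, hc, rfl⟩ := hV.exists_eq_smul hF (hE i) hp hq hpq hFpos (hEpos i)
      (by omega) hFp hFq (hEp i) ((hEq i).mono (by omega))
    refine ⟨Pi.single i c, fun l => ?_, by simpa, ?_⟩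
    · rcases eq_or_ne l i with rfl | h
      · simpa using hc.le
      · simp [h]
    · rw [Finset.sum_eq_single i (fun l _ hl => by simp [hl]) (by simp), Pi.single_eq_same]
  | succ k ih =>
    intro i j hijk F hF hFpos hFp hFq hFt
    obtain ⟨G, hG, hGpos, hGp, hGq, hGt⟩ := hV.exists_posBetween_three hp hq ht hpq hpt hqt htpq
      (by omega : (i : ℕ) + (j + 1) + k + 1 = n)
    obtain ⟨H, hH, hHpos, hHp, hHq, hHt⟩ := hV.exists_posBetween_three hp hq ht hpq hpt hqt htpq
      (by omega : (i : ℕ) + 1 + j + k + 1 = n)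
    obtain ⟨c, d, hc, hd, hcd⟩ := hV.exists_eq_smul_add_smul hF hG hH hp hq ht hpq hpt hqt hFpos
      hGpos hHpos hijk hFp hFq hFt hGp hGq hGt hHp hHq hHt
    -- `G` still has only `i` prescribed zeros at `p`, so it supplies the positive coefficient of `E
    -- i`; from `H` only nonnegativity is needed.
    obtain ⟨u, hu, hui, hGu⟩ := ih i (j + 1) (by omega) G hG hGpos hGp hGq hGt
    obtain ⟨v, hv, -, hHv⟩ := ih ⟨i + 1, by omega⟩ j (by simp; omega) H hH hHpos hHp hHq hHt
    refine ⟨fun l => c * u l + d * v l, fun l => ?_, ?_, ?_⟩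
    · have := hu l; have := hv l; positivity
    · have := hv i; positivity
    · simp only [hcd, hGu, hHv, Finset.smul_sum, add_smul, mul_smul, Finset.sum_add_distrib]

/-- A positive combination of a Bernstein-like basis at `p` and `t` is a positive combination of any
Bernstein-like basis at `p` and `q`. -/
theorem exists_pos_combination {p q t : ℝ} (hp : p ∈ Icc a b) (hq : q ∈ Icc a b)
    (ht : t ∈ Icc a b) (hpq : p ≠ q) (hpt : p ≠ t) (htpq : t ∉ uIoo p q)
    {E : Fin n → P.PFun} (hE : ∀ l, E l ∈ V) (hEpos : ∀ l, P.PosBetween (E l) p q)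
    (hEp : ∀ l, P.Vanishes (E l) p l) (hEq : ∀ l, P.Vanishes (E l) q (n - 1 - l))
    {B : Fin n → P.PFun} (hB : ∀ l, B l ∈ V) (hBpos : ∀ l, P.PosBetween (B l) p q)
    (hBp : ∀ l, P.Vanishes (B l) p l) (hBt : ∀ l, P.Vanishes (B l) t (n - 1 - l))
    {α : Fin n → ℝ} (hα : ∀ l, 0 < α l) :
    ∃ β : Fin n → ℝ, (∀ l, 0 < β l) ∧ ∑ l, α l • B l = ∑ l, β l • E l := by
  have key : ∀ i, ∃ c : Fin n → ℝ, (∀ l, 0 ≤ c l) ∧ 0 < c i ∧ B i = ∑ l, c l • E l := by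
    intro i
    -- If this end of the interval does not move, the two bases are proportional term by term; the
    -- three-point argument needs distinct points.
    rcases eq_or_ne q t with rfl | hqt
    · obtain ⟨c, hc, h⟩ := hV.exists_eq_smul (hB i) (hE i) hp hq hpq (hBpos i) (hEpos i)
        (by omega : (i : ℕ) + (n - 1 - i) + 1 = n) (hBp i) (hBt i) (hEp i) (hEq i)
      refine ⟨Pi.single i c, fun l => ?_, by simpa, ?_⟩
      · rcases eq_or_ne l i with rfl | h
        · simpa using hc.le
        · simp [h]
      · rw [Finset.sum_eq_single i (fun l _ hl => by simp [hl]) (by simp), Pi.single_eq_same, h]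
    · exact hV.exists_nonneg_combination hp hq ht hpq hpt hqt htpq hE hEpos hEp hEq (n - 1 - i) i 0
        (by omega) (B i) (hB i) (hBpos i) (hBp i) (vanishes_zero_order _ _) (hBt i)
  choose c hc hci hBc using key
  refine ⟨fun l => ∑ i, α i * c i l, fun l => ?_, ?_⟩
  · exact Finset.sum_pos' (fun i _ => mul_nonneg (hα i).le (hc i l))
      ⟨l, Finset.mem_univ l, mul_pos (hα l) (hci l)⟩
  · calc ∑ i, α i • B i = ∑ i, ∑ l, (α i * c i l) • E l := by
          refine Finset.sum_congr rfl fun i _ => ?_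
          rw [hBc i, Finset.smul_sum]
          simp only [mul_smul]
      _ = ∑ l, (∑ i, α i * c i l) • E l := by
          rw [Finset.sum_comm]
          simp only [Finset.sum_smul]

/-! ### Linear independence and restriction to a subinterval -/

/-- Elements that vanish exactly `0, …, n - 1` times at a point are linearly independent. -/
theorem linearIndependent_of_vanishes {p : ℝ} {E : Fin n → P.PFun} (hE : ∀ l, E l ∈ V)
    (hEp : ∀ l : Fin n, P.Vanishes (E l) p l) (hEp' : ∀ l : Fin n, ¬ P.Vanishes (E l) p (l + 1)) :
    LinearIndependent ℝ E := by
  rw [Fintype.linearIndependent_iff]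
  intro g hg l
  induction l using WellFoundedLT.induction with
  | ind l ih =>
    by_contra hl
    refine hEp' l ?_
    -- The coefficients below `l` are already zero. If `g l ≠ 0`, then `E l` is a combination of
    -- later elements, all of which vanish at least `l + 1` times at `p`.
    have hsum : ∑ k ∈ Finset.univ.erase l, g k • E k = ∑ k ∈ Finset.Ioi l, g k • E k := by
      refine (Finset.sum_subset (fun k hk => ?_) fun k hk hk' => ?_).symm
      · exact Finset.mem_erase.2 ⟨(Finset.mem_Ioi.1 hk).ne', Finset.mem_univ k⟩
      · rw [ih k (lt_of_le_of_ne (not_lt.1 fun h => hk' (Finset.mem_Ioi.2 h))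
          (Finset.ne_of_mem_erase hk)), zero_smul]
    rw [← Finset.add_sum_erase _ _ (Finset.mem_univ l), hsum] at hg
    have hEl : E l = ∑ k ∈ Finset.Ioi l, (-(g l)⁻¹ * g k) • E k := by
      simp only [mul_smul]
      rw [← Finset.smul_sum, neg_smul, ← smul_neg, ← eq_neg_of_add_eq_zero_left hg, smul_smul, inv_mul_cancel₀ hl, one_smul]
    rw [hEl]
    exact hV.vanishes_sum _ _ l.2 (fun k _ => hE k) fun k hk =>
      (hEp k).mono (Finset.mem_Ioi.1 hk)

/-- An element that vanishes identically on `(c, d)` is zero. -/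
theorem eq_zero_of_restrictFun_eq_zero {c d : ℝ} (hac : a ≤ c) (hcd : c < d) (hdb : d ≤ b)
    {F : P.PFun} (hF : F ∈ V) (h0 : P.restrictFun hcd F = 0) : F = 0 := by
  -- Any `n` distinct points of `(c, d)` serve as `n` zeros.
  have hinf : (Ioo c d).Infinite := Ioo_infinite hcd
  let e := hinf.natEmbedding
  refine hV.eq_zero_of_vanishes (fun l : Fin n => (e l : ℝ)) (fun k l h => ?_) (fun l => ?_)
    (fun _ => 1) (fun l => l.pos) (by simp) hF fun l => ?_
  · exact Fin.ext (e.injective (Subtype.ext h))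
  · exact ⟨hac.trans (e l).2.1.le, (e l).2.2.le.trans hdb⟩
  · have hl := (e l).2
    obtain ⟨i, hi⟩ := hV.exists_piece (t := (e l : ℝ)) ⟨hac.trans hl.1.le, hl.2.le.trans hdb⟩
    refine hV.vanishes_of_vanishesTo hF hi l.pos ((vanishesTo_one_iff _ hi).2 ?_)
    exact congrFun (congrFun h0 ⟨i, hi.1.trans_lt hl.2, hl.1.trans_le hi.2⟩)
      ⟨e l, max_le hl.1.le hi.1, le_min hl.2.le hi.2⟩

/-- Restriction to `[c, d]` does not change the zeros in `[c, d]`. -/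
theorem vanishes_restrictFun_iff {c d : ℝ} (hac : a ≤ c) (hcd : c < d) (hdb : d ≤ b)
    {F : P.PFun} (hF : F ∈ V) {t : ℝ} (ht : t ∈ Icc c d) {r : ℕ} (hr : r ≤ n) :
    (P.restrict hcd).Vanishes (P.restrictFun hcd F) t r ↔ P.Vanishes F t r := by
  have key : ∀ (i : {i : ι // P.left i < d ∧ c < P.right i}),
      t ∈ Icc ((P.restrict hcd).left i) ((P.restrict hcd).right i) → ∀ j < r,
      pieceDeriv ((P.restrict hcd).lt i) j (P.restrictFun hcd F i) t =
        pieceDeriv (P.lt i) j (F i) t := fun i hi j hj =>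
    pieceDeriv_restrict (P.lt i) ((P.restrict hcd).lt i) (le_max_right _ _) (min_le_right _ _)
      (hV.ecp.isCn F hF i) (by omega) hi
  constructor
  · intro h
    -- A piece meeting `[c, d]` only at `t` is absent from the restricted partition, so one
    -- accumulating at `t` from inside `(c, d)` is chosen.
    obtain ⟨i, hi⟩ := hV.exists_piece_closure (A := Ioo c d)
      (fun s hs => ⟨hac.trans hs.1.le, hs.2.le.trans hdb⟩) (t := t)
      (by rwa [closure_Ioo hcd.ne])
    obtain ⟨s, hs⟩ := closure_nonempty_iff.1 ⟨t, hi⟩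
    have hti : t ∈ Icc (P.left i) (P.right i) :=
      closure_minimal inter_subset_left isClosed_Icc hi
    have hti' : t ∈ Icc (max c (P.left i)) (min d (P.right i)) :=
      ⟨max_le ht.1 hti.1, le_min ht.2 hti.2⟩
    let i' : {i : ι // P.left i < d ∧ c < P.right i} :=
      ⟨i, hs.1.1.trans_lt hs.2.2, hs.2.1.trans_le hs.1.2⟩
    exact hV.vanishes_of_vanishesTo hF hti hr fun j hj =>
      (key i' hti' j hj).symm.trans (h i' hti' j hj)
  · intro h i hi j hj
    exact (key i hi j hj).trans
      (h i ⟨(le_max_right _ _).trans hi.1, hi.2.trans (min_le_right _ _)⟩ j hj)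

/-- The Bernstein-like basis on `[c, d]` given by elements of the space on `[a, b]`. -/
theorem isBernsteinLikeBasis_restrictFun {c d : ℝ} (hac : a ≤ c) (hcd : c < d) (hdb : d ≤ b)
    {E : Fin n → P.PFun} (hE : ∀ l, E l ∈ V) (hEpos : ∀ l, P.PosBetween (E l) c d)
    (hEc : ∀ l, P.Vanishes (E l) c l) (hEd : ∀ l, P.Vanishes (E l) d (n - 1 - l)) :
    (P.restrict hcd).IsBernsteinLikeBasis c d n (V.map (P.restrictFun hcd))
      (fun l => P.restrictFun hcd (E l)) := by
  have := hV.ecp.finiteDimensional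
  have hc : c ∈ Icc a b := ⟨hac, hcd.le.trans hdb⟩
  have hd : d ∈ Icc a b := ⟨hac.trans hcd.le, hdb⟩
  have hE0 := fun l => hV.ne_zero_of_posBetween hc hd hcd.ne (hEpos l)
  have hEc' : ∀ l : Fin n, ¬ P.Vanishes (E l) c (l + 1) := fun l h =>
    hV.not_vanishes_two (hE l) (hE0 l) hc hd hcd.ne (by omega) h (hEd l)
  have hEd' : ∀ l : Fin n, ¬ P.Vanishes (E l) d (n - 1 - l + 1) := fun l h =>
    hV.not_vanishes_two (hE l) (hE0 l) hc hd hcd.ne (by omega) (hEc l) h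
  have hli : LinearIndependent ℝ fun l => P.restrictFun hcd (E l) := by
    have h1 := hV.linearIndependent_of_vanishes hE hEc hEc'
    rw [Fintype.linearIndependent_iff] at h1 ⊢
    intro g hg
    refine h1 g (hV.eq_zero_of_restrictFun_eq_zero hac hcd hdb
      (V.sum_mem fun l _ => V.smul_mem _ (hE l)) ?_)
    simpa using hg
  refine ⟨hli, ?_, fun l => ?_, fun l => ?_, fun l i t hct htd => ?_⟩
  · refine Submodule.eq_of_le_of_finrank_le ?_ ?_
    · rw [Submodule.span_le]
      rintro _ ⟨l, rfl⟩
      exact Submodule.mem_map_of_mem (hE l)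
    · rw [finrank_span_eq_card hli, Fintype.card_fin, ← hV.ecp.finrank_eq]
      exact Submodule.finrank_map_le _ _
  · rw [cappedMult_eq_iff, hV.vanishes_restrictFun_iff hac hcd hdb (hE l) (left_mem_Icc.2 hcd.le)
      l.2.le, hV.vanishes_restrictFun_iff hac hcd hdb (hE l) (left_mem_Icc.2 hcd.le) l.2]
    exact ⟨l.2.le, hEc l, fun _ => hEc' l⟩
  · rw [cappedMult_eq_iff, hV.vanishes_restrictFun_iff hac hcd hdb (hE l) (right_mem_Icc.2 hcd.le)
      (by omega), hV.vanishes_restrictFun_iff hac hcd hdb (hE l) (right_mem_Icc.2 hcd.le)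
      (by omega)]
    exact ⟨by omega, hEd l, fun _ => hEd' l⟩
  · exact hEpos l i _ (by rw [uIoo_of_lt hcd]; exact ⟨hct, htd⟩)

/-- Bernstein-like bases on subintervals exist, and positive combinations of a Bernstein-like basis
on `[a, b]` are positive combinations of them. -/
theorem exists_isBernsteinLikeBasis_restrict {B : Fin n → P.PFun}
    (hB : P.IsBernsteinLikeBasis a b n V B) {α : Fin n → ℝ} (hα : ∀ l, 0 < α l) {c d : ℝ}
    (hac : a ≤ c) (hcd : c < d) (hdb : d ≤ b) :
    ∃ E : Fin n → (P.restrict hcd).PFun,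
      (P.restrict hcd).IsBernsteinLikeBasis c d n (V.map (P.restrictFun hcd)) E ∧
      ∃ β : Fin n → ℝ, (∀ l, 0 < β l) ∧
        P.restrictFun hcd (∑ l, α l • B l) = ∑ l, β l • E l := by
  have had : a < d := hac.trans_lt hcd
  have ha : a ∈ Icc a b := left_mem_Icc.2 (had.le.trans hdb)
  have hb : b ∈ Icc a b := right_mem_Icc.2 (had.le.trans hdb)
  have hc : c ∈ Icc a b := ⟨hac, hcd.le.trans hdb⟩
  have hd : d ∈ Icc a b := ⟨had.le, hdb⟩
  have hBV : ∀ l, B l ∈ V := fun l => hB.span_eq ▸ Submodule.subset_span (mem_range_self l)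
  have hBa : ∀ l, P.Vanishes (B l) a l := fun l => (cappedMult_eq_iff.1 (hB.zeros_left l)).2.1
  have hBb : ∀ l : Fin n, P.Vanishes (B l) b (n - 1 - l) := fun l =>
    (cappedMult_eq_iff.1 (hB.zeros_right l)).2.1
  have hBpos : ∀ l, P.PosBetween (B l) a d := fun l i t ht => by
    rw [uIoo_of_lt had] at ht
    exact hB.pos l i t ht.1 (ht.2.trans_le hdb)
  choose E hE hEpos hEa hEd using fun l : Fin n => hV.exists_posBetween_two ha hd had.ne
    (by omega : (l : ℕ) + (n - 1 - l) + 1 = n)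
  choose G hG hGpos hGc hGd using fun l : Fin n => hV.exists_posBetween_two hc hd hcd.ne
    (by omega : (l : ℕ) + (n - 1 - l) + 1 = n)
  -- First cut: `a` stays fixed and the right end moves from `b` to `d`.
  obtain ⟨β, hβ, hBE⟩ := hV.exists_pos_combination ha hd hb had.ne (had.trans_le hdb).ne
    (by rw [uIoo_of_lt had]; exact fun h => h.2.not_ge hdb) hE hEpos hEa hEd hBV hBpos hBa hBb hα
  have hrev : ∀ l : Fin n, n - 1 - (l.rev : ℕ) = l := fun l => by rw [Fin.val_rev]; omega
  have hrev' : ∀ l : Fin n, n - 1 - (l : ℕ) = l.rev := fun l => by rw [Fin.val_rev]; omega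
  -- Second cut: `d` stays fixed and the left end moves from `a` to `c`. Zeros are now counted from
  -- the right end, so the indices are reversed.
  obtain ⟨γ, hγ, hEG⟩ := hV.exists_pos_combination hd hc ha hcd.ne' had.ne'
    (by rw [uIoo_of_gt hcd]; exact fun h => h.1.not_ge hac)
    (E := fun l => G l.rev) (fun l => hG _) (fun l => by unfold PosBetween; rw [uIoo_comm]; exact hGpos _)
    (fun l => hrev l ▸ hGd l.rev) (fun l => (hrev' l).symm ▸ hGc l.rev)
    (B := fun l => E l.rev) (fun l => hE _)
    (fun l i t ht => hEpos _ i t (by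
      rw [uIoo_of_gt hcd] at ht
      rw [uIoo_of_lt had]
      exact ⟨hac.trans_lt ht.1, ht.2⟩))
    (fun l => hrev l ▸ hEd l.rev) (fun l => (hrev' l).symm ▸ hEa l.rev)
    (α := fun l => β l.rev) (fun l => hβ _)
  refine ⟨_, hV.isBernsteinLikeBasis_restrictFun hac hcd hdb hG hGpos hGc hGd,
    fun l => γ l.rev, fun l => hγ _, ?_⟩
  have h1 : ∑ l, β l • E l = ∑ l, γ (Fin.rev l) • G l := by
    rw [← Equiv.sum_comp Fin.revPerm fun l => β l • E l,
      ← Equiv.sum_comp Fin.revPerm fun l => γ (Fin.rev l) • G l]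
    simpa using hEG
  rw [hBE, h1]
  simp

end IsConnectedECPSpace

end IntervalFamily

/-! ### The derivatives of a spline space -/

/-- Triangularity removes the entries after `j`, and the first column removes the entry of index
`0`. The latter matters because zeros of `DF` say nothing about the value of `F` itself. -/
theorem IsConnectionMatrix.mulVec_apply_of_eq_zero {m : ℕ} {R : Matrix (Fin m) (Fin m) ℝ}
    (hR : IsConnectionMatrix R) (v : Fin m → ℝ) (j : Fin m) (hj : (j : ℕ) ≠ 0)
    (hv : ∀ s < j, (s : ℕ) ≠ 0 → v s = 0) : R.mulVec v j = R j j * v j := by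
  rw [Matrix.mulVec, dotProduct, Finset.sum_eq_single j _ (by simp)]
  intro s _ hs
  rcases lt_or_gt_of_ne hs with h | h
  · by_cases h0 : (s : ℕ) = 0
    · rw [hR.first_col j s h0, if_neg (fun hjs : j = s => hj (hjs ▸ h0)), zero_mul]
    · rw [hv s h h0, mul_zero]
  · rw [hR.lower j s h, zero_mul]

section knots

variable {k : ℕ} {x : Fin (k + 2) → ℝ} (hx : StrictMono x)

theorem knotPartition_carrier :
    (knotPartition x hx).carrier = Icc (x 0) (x (Fin.last (k + 1))) := by
  ext t
  constructor
  · rintro ⟨i, hi⟩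
    exact ⟨(hx.monotone (Fin.zero_le _)).trans hi.1, hi.2.trans (hx.monotone (Fin.le_last _))⟩
  · rintro ⟨h0, h1⟩
    have key : ∀ j : Fin (k + 2), t ≤ x j → t ∈ (knotPartition x hx).carrier := by
      intro j
      induction j using Fin.induction with
      | zero =>
        intro h
        exact ⟨0, h0, h.trans (hx.monotone (Fin.zero_le _))⟩
      | succ i ih =>
        intro h
        rcases le_total t (x i.castSucc) with h' | h'
        exacts [ih h', ⟨i, h', h⟩]
    exact key _ h1

/-- Only neighbouring intervals meet, so comparing two pieces at a point involves a single
connection matrix. -/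
theorem knotPartition_common_point {t : ℝ} {i j : Fin (k + 1)} (hij : i < j)
    (hi : t ∈ Icc ((knotPartition x hx).left i) ((knotPartition x hx).right i))
    (hj : t ∈ Icc ((knotPartition x hx).left j) ((knotPartition x hx).right j)) :
    ∃ l : Fin k, i = l.castSucc ∧ j = l.succ ∧ t = x l.succ.castSucc := by
  have h1 : x j.castSucc ≤ x i.succ := hj.1.trans hi.2
  have h2 : (j : ℕ) ≤ i + 1 := by
    have := hx.le_iff_le.1 h1
    simpa [Fin.le_def] using this
  have h3 : (i : ℕ) < j := hij
  have hik : (i : ℕ) < k := by omega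
  have e1 : i = (⟨i, hik⟩ : Fin k).castSucc := rfl
  have e2 : j = (⟨i, hik⟩ : Fin k).succ := Fin.ext (by simp; omega)
  refine ⟨⟨i, hik⟩, e1, e2, le_antisymm ?_ ?_⟩
  · have := hi.2
    rwa [e1] at this
  · have := hj.1
    rwa [e2] at this

variable {m : ℕ} {U : ∀ i : Fin (k + 1), Submodule ℝ (Icc (x i.castSucc) (x i.succ) → ℝ)}
  {R : Fin k → Matrix (Fin m) (Fin m) ℝ}

/-- At a knot the first nonzero derivatives of an element of `DS` from the right and from the left
are positive multiples of each other. -/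
theorem pieceDeriv_knot (hR : ∀ i, IsConnectionMatrix (R i)) {F : (knotPartition x hx).PFun}
    (hF : F ∈ (knotPartition x hx).derivSpace (splineSpace m x hx U R)) (l : Fin k) {j : ℕ}
    (hj : j + 1 < m)
    (hv : VanishesTo ((knotPartition x hx).lt l.castSucc) (F l.castSucc) (x l.succ.castSucc) j) :
    ∃ ρ : ℝ, 0 < ρ ∧ pieceDeriv ((knotPartition x hx).lt l.succ) j (F l.succ) (x l.succ.castSucc) =
      ρ * pieceDeriv ((knotPartition x hx).lt l.castSucc) j (F l.castSucc) (x l.succ.castSucc) := by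
  obtain ⟨F, hFS, -, rfl⟩ := hF
  have hl : x l.succ.castSucc ∈ Icc ((knotPartition x hx).left l.castSucc)
      ((knotPartition x hx).right l.castSucc) :=
    ⟨hx.monotone (by simp [Fin.le_def]), (congrArg x (Fin.succ_castSucc l)).ge⟩
  have hr : x l.succ.castSucc ∈ Icc ((knotPartition x hx).left l.succ)
      ((knotPartition x hx).right l.succ) :=
    ⟨le_rfl, hx.monotone (Fin.castSucc_lt_succ (i := l.succ)).le⟩
  -- The `j`-th derivative of `DF` is the derivative of order `j + 1` of `F`, hence the row `j + 1`.
  have h := congrFun (hFS.2.2 l) ⟨j + 1, hj⟩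
  rw [(hR l).mulVec_apply_of_eq_zero _ _ (Nat.succ_ne_zero j)] at h
  · refine ⟨_, (hR l).diag_pos ⟨j + 1, hj⟩, ?_⟩
    exact (pieceDeriv_pieceDeriv_one _ hr).trans
      (h.trans (congrArg _ (pieceDeriv_pieceDeriv_one _ hl).symm))
  · intro s hs hs0
    obtain ⟨i, hi⟩ := Nat.exists_eq_succ_of_ne_zero hs0
    have hij : i < j := by
      have : (s : ℕ) < j + 1 := hs
      omega
    have := (pieceDeriv_pieceDeriv_one ((knotPartition x hx).lt l.castSucc) hl).symm.trans (hv i hij)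
    rw [jet, hi]
    exact this

/-- The first derivative that may be nonzero is multiplied by a positive diagonal entry at a knot,
so orders of vanishing pass in both directions by induction, and order zero gives the signs. -/
theorem isConnectedECPSpace_derivSpace (hR : ∀ i, IsConnectionMatrix (R i))
    (hDS : (knotPartition x hx).IsECPSpace (m - 1)
      ((knotPartition x hx).derivSpace (splineSpace m x hx U R))) :
    (knotPartition x hx).IsConnectedECPSpace (x 0) (x (Fin.last (k + 1))) (m - 1)
      ((knotPartition x hx).derivSpace (splineSpace m x hx U R)) where
  finite := inferInstance
  carrier_eq := knotPartition_carrier hx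
  ecp := hDS
  vanishesTo := by
    intro F hF i j t hi hj r hr hv s
    induction s using Nat.strong_induction_on with
    | _ s ih =>
    intro hs
    have ihv : VanishesTo ((knotPartition x hx).lt j) (F j) t s :=
      fun u hu => ih u hu (hu.trans hs)
    rcases lt_trichotomy i j with hij | rfl | hij
    · obtain ⟨l, rfl, rfl, rfl⟩ := knotPartition_common_point hx hij hi hj
      obtain ⟨ρ, -, h⟩ := pieceDeriv_knot hx hR hF l (by omega : s + 1 < m) (hv.mono _ hs.le)
      rw [h, hv s hs, mul_zero]
    · exact hv s hs
    -- From right to left, the lower derivatives on the left vanish by induction, and the positive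
    -- factor is cancelled.
    · obtain ⟨l, rfl, rfl, rfl⟩ := knotPartition_common_point hx hij hj hi
      obtain ⟨ρ, hρ, h⟩ := pieceDeriv_knot hx hR hF l (by omega : s + 1 < m) ihv
      rw [hv s hs] at h
      exact (mul_eq_zero.1 h.symm).resolve_left hρ.ne'
  pos := by
    intro F hF i j t hi hj hpos
    -- If `m ≤ 1`, then `m - 1 = 0` and the zero bound leaves no nonzero element, contradicting
    -- `hpos`.
    have hm : 0 + 1 < m := by
      by_contra hm
      refine absurd (hDS.zeros F hF fun h => ?_) (by simp [show m - 1 = 0 by omega])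
      rw [h] at hpos
      exact lt_irrefl _ hpos
    rw [← pieceDeriv_zero_order ((knotPartition x hx).lt i) (f := F i) hi] at hpos
    rw [← pieceDeriv_zero_order ((knotPartition x hx).lt j) (f := F j) hj]
    rcases lt_trichotomy i j with hij | rfl | hij
    · obtain ⟨l, rfl, rfl, rfl⟩ := knotPartition_common_point hx hij hi hj
      obtain ⟨ρ, hρ, h⟩ := pieceDeriv_knot hx hR hF l hm (fun _ h => absurd h (Nat.not_lt_zero _))
      rw [h]
      exact mul_pos hρ hpos
    · exact hpos
    · obtain ⟨l, rfl, rfl, rfl⟩ := knotPartition_common_point hx hij hj hi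
      obtain ⟨ρ, hρ, h⟩ := pieceDeriv_knot hx hR hF l hm (fun _ h => absurd h (Nat.not_lt_zero _))
      rw [h] at hpos
      exact pos_of_mul_pos_right hpos hρ.le

end knots

theorem mainTheorem4 (m k : ℕ) (x : Fin (k + 2) → ℝ) (hx : StrictMono x)
    (U : ∀ i : Fin (k + 1), Submodule ℝ (Icc (x i.castSucc) (x i.succ) → ℝ))
    (hU : ∀ i, IsECSpace ((knotPartition x hx).lt i) m (U i))
    (R : Fin k → Matrix (Fin m) (Fin m) ℝ) (hR : ∀ i, IsConnectionMatrix (R i))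
    (hconst : ∀ a : ℝ, (fun _ _ => a) ∈ splineSpace m x hx U R)
    (hDS : (knotPartition x hx).IsECPSpace (m - 1)
      ((knotPartition x hx).derivSpace (splineSpace m x hx U R)))
    (w : (knotPartition x hx).PFun)
    (hw : ∃ B : Fin (m - 1) → (knotPartition x hx).PFun,
      (knotPartition x hx).IsBernsteinLikeBasis (x 0) (x (Fin.last (k + 1))) (m - 1)
        ((knotPartition x hx).derivSpace (splineSpace m x hx U R)) B ∧
      ∃ α : Fin (m - 1) → ℝ, (∀ l, 0 < α l) ∧ w = ∑ l, α l • B l)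
    (c d : ℝ) (hac : x 0 ≤ c) (hcd : c < d) (hdb : d ≤ x (Fin.last (k + 1))) :
    ∃ B : Fin (m - 1) → ((knotPartition x hx).restrict hcd).PFun,
      ((knotPartition x hx).restrict hcd).IsBernsteinLikeBasis c d (m - 1)
        (((knotPartition x hx).derivSpace (splineSpace m x hx U R)).map
          ((knotPartition x hx).restrictFun hcd)) B ∧
      ∃ β : Fin (m - 1) → ℝ, (∀ l, 0 < β l) ∧
        (knotPartition x hx).restrictFun hcd w = ∑ l, β l • B l := by
  obtain ⟨B, hB, α, hα, rfl⟩ := hw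
  exact (isConnectedECPSpace_derivSpace hx hR hDS).exists_isBernsteinLikeBasis_restrict hB hα hac hcd hdb
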